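/- **Contests.** Two players $A,B$ compete for a prize $v>0$ in a sequence of battles. In each battle the players simultaneously choose efforts $x_A,x_B\ge 0$ (effort is also its cost); $A$ wins the battle with probability $p(x_A,x_B)$ and $B$ with probability $p(x_B,x_A)=1-p(x_A,x_B)$. Assume that for $(x,x')\neq(0,0)$ one has $p(x,x')=\gamma(x/x')$, where $\gamma:[0,\infty]\to[0,1]$ is continuous, $\gamma(0)=0$, $\gamma(\infty)=1$, $\gamma(t)+\gamma(1/t)=1$, and $\gamma$ is twice differentiable on $(0,\infty)$ with $\gamma'>0$ and $\gamma''\le 0$. A contest is given by a set of terminal sequences of battle winners, none a proper prefix of another, with a final winner for each finite one; every infinite sequence without a terminal finite prefix is terminal. A history is a sequence of battle winners no proper prefix of which is terminal. The final winner gets $v$ (each player gets $v/2$ if the contest never ends), and each player pays all of his efforts. Past outcomes are observed. An equilibrium is a subgame-perfect equilibrium in pure strategies. A contest is symmetric if its rules do not depend on the players' identities, and exchangeable if any two histories that differ only in the order of the battle outcomes lead to the same subgame or final outcome. For a symmetric exchangeable contest $\mathcal M$ and $N\ge 2$, a symmetric exchangeable contest $\mathcal M'$ is an $N$-extension of $\mathcal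 M$ if its subgame after $(A,B)$ and after $(B,A)$ is $\mathcal M$, and, from the start of $\mathcal M'$, a player wins the contest by winning exactly $N$ battles in a row. **Proposition (Limit of Exchangeable Contests).** There is a constant $\widetilde\alpha>0$, depending only on the success function $p$, such that the following holds for every $v>0$. Let $(\mathcal M_k)_{k\ge1}$ be a sequence of contests such that $\mathcal M_1$ is a single battle for the prize (put $N_1=1$) and, for every $k\geq 1$, $\mathcal M_{k+1}$ is an $N_{k+1}$-extension of $\mathcal M_k$ in which a player who wins the first $i$ battles and then loses one, where $N_k<i<N_{k+1}$, wins the contest at that point (this is automatic if $N_{k+1}\le N_k+2$). Let $V_{0;k}$ be the payoff of a player in an equilibrium of $\mathcal M_k$, and suppose that $\lim_{k\to\infty}V_{0;k}$ exists. Then $$\lim_{k\to\infty}V_{0;k}\ \ge\ \widetilde\alpha\,v ,$$ and the expected total effort of the two players in these equilibria converges as $k\to\infty$ to a limit that is less than $(1-2\widetilde\alpha)v$. So rent does not fully dissipate in the limit. -/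

import Mathlib

open Filter Topology
open scoped ENNReal NNReal

/-- The two contestants. -/
inductive Player where
  | A
  | B
deriving DecidableEq

/-- The opponent of a player. -/
def Player.other : Player → Player
  | .A => .B
  | .B => .A

/-- A homogeneous (of degree zero) success function: `p x x'` is the probability that a player
exerting effort `x` wins a battle against an opponent exerting effort `x'`, and it equals
`γ (x / x')` (with `x / 0 = ∞` for `x > 0`).  The ratio `0 / 0` is not covered by `γ`;
`add_eq_one` forces `p 0 0 = 1 / 2`. -/
structure IsHomogeneousSuccess (p : ℝ≥0 → ℝ≥0 → ℝ) (γ : ℝ≥0∞ → ℝ) : Prop where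
  add_eq_one : ∀ x x', p x x' + p x' x = 1
  eq_ratio : ∀ x x', ¬ (x = 0 ∧ x' = 0) → p x x' = γ ((x : ℝ≥0∞) / (x' : ℝ≥0∞))
  mem_unit : ∀ t, γ t ∈ Set.Icc (0 : ℝ) 1
  continuous : Continuous γ
  zero : γ 0 = 0
  top : γ ⊤ = 1
  inv : ∀ t, γ t + γ t⁻¹ = 1
  differentiable : ∀ t : ℝ, 0 < t → DifferentiableAt ℝ (fun s : ℝ => γ (ENNReal.ofReal s)) t
  differentiable_deriv : ∀ t : ℝ, 0 < t →
    DifferentiableAt ℝ (deriv (fun s : ℝ => γ (ENNReal.ofReal s))) t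
  deriv_pos : ∀ t : ℝ, 0 < t → 0 < deriv (fun s : ℝ => γ (ENNReal.ofReal s)) t
  deriv_deriv_nonpos : ∀ t : ℝ, 0 < t →
    deriv (deriv (fun s : ℝ => γ (ENNReal.ofReal s))) t ≤ 0

/-- A multi-battle contest.  A finite outcome path is the list of the battle winners, in
chronological order.  `outcome h = some ℓ` means that `h` is a terminal history at which `ℓ` is the
final winner; `outcome h = none` means that `h` is not terminal.  The infinite terminal histories
are the infinite paths without a terminal finite prefix. -/
structure Contest where
  outcome : List Player → Option Player
  outcome_nil : outcome [] = none
  /-- No terminal history is a proper prefix of another one. -/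
  no_redundancy : ∀ h w : List Player, outcome h ≠ none → w ≠ [] → outcome (h ++ w) = none

namespace Contest

/-- `h` is a history: no proper prefix of `h` is terminal. -/
def IsHistory (M : Contest) (h : List Player) : Prop :=
  ∀ g : List Player, g <+: h → g ≠ h → M.outcome g = none

/-- `h` is a non-terminal history: a further battle is fought at `h`. -/
def IsLive (M : Contest) (h : List Player) : Prop :=
  M.IsHistory h ∧ M.outcome h = none

/-- The rules do not depend on the identities of the players. -/
def IsSymmetric (M : Contest) : Prop :=
  ∀ h : List Player, M.outcome (h.map Player.other) = (M.outcome h).map Player.other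

/-- Two histories that differ only in the order of the battle outcomes lead to the same subgame
or (the case `w = []`) the same final outcome. -/
def IsExchangeable (M : Contest) : Prop :=
  ∀ h h' : List Player, M.IsHistory h → M.IsHistory h' → h.Perm h' →
    ∀ w : List Player, M.outcome (h ++ w) = M.outcome (h' ++ w)

/-- The contest consisting of a single battle, whose winner gets the prize. -/
def IsSingleBattle (M : Contest) : Prop :=
  ∀ ℓ : Player, M.outcome [ℓ] = some ℓ

/-- `M'` is the `N`-extension of the symmetric exchangeable contest `M`. -/
structure IsExtension (M' : Contest) (N : ℕ) (M : Contest) : Prop where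
  two_le : 2 ≤ N
  symmetric_base : M.IsSymmetric
  exchangeable_base : M.IsExchangeable
  symmetric : M'.IsSymmetric
  exchangeable : M'.IsExchangeable
  /-- The subgame after `(A, B)` or `(B, A)` is `M`. -/
  subgame : ∀ (ℓ : Player) (w : List Player), M'.outcome (ℓ :: ℓ.other :: w) = M.outcome w
  /-- A player wins the contest by winning exactly `N` battles in a row from the start. -/
  streak : ∀ ℓ : Player, M'.outcome (List.replicate N ℓ) = some ℓ

end Contest

/-- A profile of pure strategies: the effort of each player after each history. -/
abbrev Profile := Player → List Player → ℝ≥0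

/-- Probability that, starting from `h`, the next battle outcomes are those listed in `w`. -/
noncomputable def reachProb (p : ℝ≥0 → ℝ≥0 → ℝ) (σ : Profile) :
    List Player → List Player → ℝ≥0∞
  | _, [] => 1
  | h, ℓ :: w =>
      ENNReal.ofReal (p (σ ℓ h) (σ ℓ.other h)) * reachProb p σ (h ++ [ℓ]) w

namespace Contest

/-- Probability, from history `h` on, that `ℓ` wins the contest after finitely many battles. -/
noncomputable def winProb (M : Contest) (p : ℝ≥0 → ℝ≥0 → ℝ) (σ : Profile) (ℓ : Player)
    (h : List Player) : ℝ≥0∞ :=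
  ∑' w : List Player, if M.outcome (h ++ w) = some ℓ then reachProb p σ h w else 0

open Classical in
/-- Expected sum of the efforts of player `ℓ` in all battles from history `h` on. -/
noncomputable def expectedEffort (M : Contest) (p : ℝ≥0 → ℝ≥0 → ℝ) (σ : Profile) (ℓ : Player)
    (h : List Player) : ℝ≥0∞ :=
  ∑' w : List Player,
    if M.IsLive (h ++ w) then reachProb p σ h w * (σ ℓ (h ++ w) : ℝ≥0∞) else 0

/-- Expected total effort of both players in the whole contest. -/
noncomputable def totalEffort (M : Contest) (p : ℝ≥0 → ℝ≥0 → ℝ) (σ : Profile) : ℝ≥0∞ :=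
  M.expectedEffort p σ .A [] + M.expectedEffort p σ .B []

/-- Expected payoff of player `ℓ` from history `h` on: the winner gets `v`, each player gets
`v / 2` at an infinite terminal history, and efforts are deducted. -/
noncomputable def payoff (M : Contest) (p : ℝ≥0 → ℝ≥0 → ℝ) (v : ℝ) (σ : Profile) (ℓ : Player)
    (h : List Player) : EReal :=
  ((v * (M.winProb p σ ℓ h).toReal
      + v / 2 * (1 - (M.winProb p σ ℓ h).toReal - (M.winProb p σ ℓ.other h).toReal) : ℝ) : EReal)
    - (M.expectedEffort p σ ℓ h : EReal)

/-- `σ` is a subgame-perfect equilibrium: after no history does a player gain by switching to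
another strategy. -/
def IsEquilibrium (M : Contest) (p : ℝ≥0 → ℝ≥0 → ℝ) (v : ℝ) (σ : Profile) : Prop :=
  ∀ h : List Player, M.IsLive h → ∀ (ℓ : Player) (τ : List Player → ℝ≥0),
    M.payoff p v (Function.update σ ℓ τ) ℓ h ≤ M.payoff p v σ ℓ h

end Contest

/-!
In a single battle with positive stakes `a` and `b` (victory payoff minus defeat payoff) the
first-order conditions force the effort ratio `a / b`, and the player with stake `a` ends up with
his defeat payoff plus `netShare γ (a / b) * a`, where `netShare γ t = γ t - t γ' t`.  If some player
has no positive stake, nobody exerts effort.  So a battle has at most one pair of equilibrium payoffs,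
and since all contests in the sequence have bounded length, backward induction shows that
equilibrium payoffs depend only on the subgame (`Contest.IsValue.eq_of_subgame_eq`).

Let `f k i` and `g k i` be the payoffs in the `k`-th contest of a player who has won the first `i`
battles and of his opponent.  By exchangeability, a loss after `i + 1` wins in contest `k + 1` leads
to the payoffs `f k i` and `g k i` (`Contest.isStreakValue`).  For the battle after `i` wins, the
equilibrium formulas give, with constants `s` and `q = 3 / 5` that depend only on `γ`,
`f (k + 1) (i + 1) - f (k + 1) i ≤ q * (f (k + 1) i - f k (i - 1))`
`  + 2 * s * (g k (i - 1) - g (k + 1) i)`: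
if the stake of the leader dominates, his net share is at least `5 / 8`, and otherwise his stake is
at most a multiple of that of his opponent (`IsBattleValue.sub_le`).

Summed over `i`, the left side telescopes to `v - f (k + 1) 1`, and the right side is at most `q * v`,
plus a multiple of the payoff `f (k + 1) 0` at the start, plus the decrease from `k` to `k + 1` of
the nonnegative potential `∑ i, (q * (v - f k i) + 2 * s * g k i)`.  As
`netShare γ 1 * f (k + 1) 1 ≤ f (k + 1) 0`, this bounds `(1 - q) * v` by a multiple of `f (k + 1) 0`
plus that decrease (`IsStreakValue.prize_le`).  Averaging over `k`, the potential drops out, and the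
averages of `f k 0`, hence their limit, are at least a fixed multiple of `v`.  The statement on
efforts follows because the total effort is `v` minus the sum of the two payoffs.
-/

/-! ### The success function on the positive reals -/

/-- The restriction of `γ` to real ratios (negative ratios are sent to `γ 0`). -/
noncomputable def onReal (γ : ℝ≥0∞ → ℝ) (t : ℝ) : ℝ := γ (ENNReal.ofReal t)

/-- In an equilibrium of a single battle with effort ratio `t`, the share of his stake that a player
expects to keep net of his effort: `γ t - t γ' t`. -/
noncomputable def netShare (γ : ℝ≥0∞ → ℝ) (t : ℝ) : ℝ := onReal γ t - t * deriv (onReal γ) t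

namespace IsHomogeneousSuccess

variable {p : ℝ≥0 → ℝ≥0 → ℝ} {γ : ℝ≥0∞ → ℝ}

lemma onReal_le_one (hp : IsHomogeneousSuccess p γ) (t : ℝ) : onReal γ t ≤ 1 := (hp.mem_unit _).2

lemma continuous_onReal (hp : IsHomogeneousSuccess p γ) : Continuous (onReal γ) :=
  hp.continuous.comp ENNReal.continuous_ofReal

lemma onReal_zero (hp : IsHomogeneousSuccess p γ) : onReal γ 0 = 0 := by
  simp [onReal, hp.zero]

lemma differentiableAt_onReal (hp : IsHomogeneousSuccess p γ) {t : ℝ} (ht : 0 < t) :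
    DifferentiableAt ℝ (onReal γ) t := hp.differentiable t ht

lemma deriv_onReal_pos (hp : IsHomogeneousSuccess p γ) {t : ℝ} (ht : 0 < t) :
    0 < deriv (onReal γ) t := hp.deriv_pos t ht

lemma concaveOn_onReal (hp : IsHomogeneousSuccess p γ) :
    ConcaveOn ℝ (Set.Ici 0) (onReal γ) := by
  apply concaveOn_of_deriv2_nonpos (convex_Ici 0) hp.continuous_onReal.continuousOn
  · rw [interior_Ici]
    exact fun t ht => (hp.differentiable t ht).differentiableWithinAt
  · rw [interior_Ici]
    exact fun t ht => (hp.differentiable_deriv t ht).differentiableWithinAt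
  · rw [interior_Ici]
    exact fun t ht => hp.deriv_deriv_nonpos t ht

lemma onReal_add_onReal_inv (hp : IsHomogeneousSuccess p γ) {t : ℝ} (ht : 0 < t) :
    onReal γ t + onReal γ t⁻¹ = 1 := by
  simp only [onReal, ENNReal.ofReal_inv_of_pos ht, hp.inv]

lemma deriv_onReal_inv (hp : IsHomogeneousSuccess p γ) {t : ℝ} (ht : 0 < t) :
    deriv (onReal γ) t⁻¹ = t ^ 2 * deriv (onReal γ) t := by
  have h1 : HasDerivAt (fun s => onReal γ s + onReal γ s⁻¹)
      (deriv (onReal γ) t + deriv (onReal γ) t⁻¹ * -(t ^ 2)⁻¹) t :=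
    (hp.differentiableAt_onReal ht).hasDerivAt.add
      ((hp.differentiableAt_onReal (inv_pos.2 ht)).hasDerivAt.comp t (hasDerivAt_inv ht.ne'))
  have h2 : HasDerivAt (fun s => onReal γ s + onReal γ s⁻¹) 0 t :=
    (hasDerivAt_const t (1 : ℝ)).congr_of_eventuallyEq
      ((eventually_gt_nhds ht).mono fun s hs => hp.onReal_add_onReal_inv hs)
  have := h1.unique h2
  field_simp at this
  rw [one_div] at this
  linarith

lemma sub_mul_deriv_le (hp : IsHomogeneousSuccess p γ) {s t : ℝ} (hs : 0 ≤ s) (hst : s < t) :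
    (t - s) * deriv (onReal γ) t ≤ onReal γ t - onReal γ s := by
  have := hp.concaveOn_onReal.deriv_le_slope (Set.mem_Ici.2 hs) (Set.mem_Ici.2 (hs.trans hst.le))
    hst (hp.differentiableAt_onReal (hs.trans_lt hst))
  rwa [slope_def_field, le_div_iff₀ (sub_pos.2 hst), mul_comm] at this

lemma netShare_nonneg (hp : IsHomogeneousSuccess p γ) {t : ℝ} (ht : 0 < t) :
    0 ≤ netShare γ t := by
  have := hp.sub_mul_deriv_le le_rfl ht
  rw [hp.onReal_zero] at this
  rw [netShare]
  linarith

lemma netShare_lt_onReal (hp : IsHomogeneousSuccess p γ) {t : ℝ} (ht : 0 < t) :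
    netShare γ t < onReal γ t :=
  sub_lt_self _ (mul_pos ht (hp.deriv_onReal_pos ht))

lemma netShare_lt_one (hp : IsHomogeneousSuccess p γ) {t : ℝ} (ht : 0 < t) :
    netShare γ t < 1 :=
  (hp.netShare_lt_onReal ht).trans_le (hp.onReal_le_one t)

lemma onReal_one (hp : IsHomogeneousSuccess p γ) : onReal γ 1 = 1 / 2 := by
  have := hp.onReal_add_onReal_inv one_pos
  rw [inv_one] at this
  linarith

lemma netShare_one_lt_half (hp : IsHomogeneousSuccess p γ) : netShare γ 1 < 1 / 2 :=
  (hp.netShare_lt_onReal one_pos).trans_eq hp.onReal_one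

/-- Differentiating `γ' (1 / t) = t² γ' t` at `t = 1` gives `γ'' 1 = - γ' 1 ≠ 0`.  Were the net
share zero at `1`, it would have a minimum there, and its derivative `- γ'' 1` would vanish. -/
lemma netShare_one_pos (hp : IsHomogeneousSuccess p γ) : 0 < netShare γ 1 := by
  refine lt_of_le_of_ne (hp.netShare_nonneg one_pos) fun h0 => ?_
  have hd : HasDerivAt (deriv (onReal γ)) (deriv (deriv (onReal γ)) 1) 1 :=
    (hp.differentiable_deriv 1 one_pos).hasDerivAt
  have h1 : HasDerivAt (fun s => deriv (onReal γ) s⁻¹)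
      (deriv (deriv (onReal γ)) 1 * -((1 : ℝ) ^ 2)⁻¹) 1 := by
    have hd' : HasDerivAt (deriv (onReal γ)) (deriv (deriv (onReal γ)) 1) (1 : ℝ)⁻¹ := by
      simpa using hd
    exact hd'.comp (1 : ℝ) (hasDerivAt_inv one_ne_zero)
  have h2 : HasDerivAt (fun s => deriv (onReal γ) s⁻¹)
      ((2 : ℕ) * (1 : ℝ) ^ (2 - 1) * deriv (onReal γ) 1
        + (1 : ℝ) ^ 2 * deriv (deriv (onReal γ)) 1) 1 :=
    ((hasDerivAt_pow 2 (1 : ℝ)).mul hd).congr_of_eventuallyEq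
      ((eventually_gt_nhds one_pos).mono fun s hs => hp.deriv_onReal_inv hs)
  have h3 := h1.unique h2
  have h4 : HasDerivAt (netShare γ) (deriv (onReal γ) 1 -
      (1 * deriv (onReal γ) 1 + 1 * deriv (deriv (onReal γ)) 1)) 1 :=
    (hp.differentiableAt_onReal one_pos).hasDerivAt.sub ((hasDerivAt_id (1 : ℝ)).mul hd)
  have h5 : IsLocalMin (netShare γ) 1 :=
    (eventually_gt_nhds one_pos).mono fun s hs => h0.symm.trans_le (hp.netShare_nonneg hs)
  have h6 := h5.hasDerivAt_eq_zero h4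
  have := hp.deriv_onReal_pos one_pos
  norm_num at h3
  linarith

/-- Since `t γ' t ≤ 2 (γ t - γ (t / 2))` and `γ` tends to `1`, the net share of a player whose stake
dominates tends to `1`. -/
lemma exists_forall_le_netShare (hp : IsHomogeneousSuccess p γ) :
    ∃ s : ℝ, 0 < s ∧ ∀ t, s ≤ t → 5 / 8 ≤ netShare γ t := by
  have hlim : Tendsto (onReal γ) atTop (𝓝 1) := by
    have := (hp.continuous.tendsto ⊤).comp ENNReal.tendsto_ofReal_atTop
    rwa [hp.top] at this
  obtain ⟨s, hs⟩ := eventually_atTop.1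
    (hlim.eventually (lt_mem_nhds (by norm_num : (7 / 8 : ℝ) < 1)))
  refine ⟨2 * max s 1, by positivity, fun t ht => ?_⟩
  have h1 : max s 1 ≤ t / 2 := by linarith
  have ht0 : 0 < t := by linarith [le_max_right s 1]
  have h2 := hs (t / 2) ((le_max_left _ _).trans h1)
  have h3 := hp.sub_mul_deriv_le (by linarith : 0 ≤ t / 2) (by linarith : t / 2 < t)
  have h4 := hp.onReal_le_one t
  rw [netShare]
  linarith

/-- For effort ratios `t ≤ s` the shares of the stakes that the two players fail to keep are
comparable, because concavity gives `γ t ≥ t γ s / s`. -/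
lemma one_sub_netShare_mul_le (hp : IsHomogeneousSuccess p γ) {s : ℝ} (hs : 0 < s)
    (h : 1 / 2 ≤ onReal γ s) {t : ℝ} (ht : 0 < t) (hts : t ≤ s) :
    (1 - netShare γ t) * t ≤ 2 * s * (1 - netShare γ t⁻¹) := by
  have h1 : 1 - netShare γ t⁻¹ = onReal γ t + t * deriv (onReal γ) t := by
    rw [netShare, hp.deriv_onReal_inv ht, ← hp.onReal_add_onReal_inv ht]
    field_simp
    ring
  have h2 : t / s * onReal γ s ≤ onReal γ t := by
    have := hp.concaveOn_onReal.2 (Set.mem_Ici.2 le_rfl) (Set.mem_Ici.2 hs.le)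
      (sub_nonneg.2 ((div_le_one hs).2 hts)) (div_pos ht hs).le (by ring)
    simp only [smul_eq_mul, mul_zero, zero_add, hp.onReal_zero, div_mul_cancel₀ t hs.ne'] at this
    exact this
  have h3 : t ≤ 2 * s * onReal γ t := by
    have h4 : t / s * (1 / 2) ≤ onReal γ t :=
      (mul_le_mul_of_nonneg_left h (div_pos ht hs).le).trans h2
    have := mul_le_mul_of_nonneg_left h4 (by positivity : 0 ≤ 2 * s)
    calc t = 2 * s * (t / s * (1 / 2)) := by field_simp
      _ ≤ _ := this
  rw [h1]
  have h5 := mul_pos ht (hp.deriv_onReal_pos ht)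
  have h6 := mul_nonneg (hp.netShare_nonneg ht) ht.le
  nlinarith [mul_pos hs h5]

/-! ### Equilibria of a single battle -/

lemma apply_of_pos (hp : IsHomogeneousSuccess p γ) (x : ℝ≥0) {y : ℝ≥0} (hy : 0 < y) :
    p x y = onReal γ (x / y) := by
  rw [hp.eq_ratio x y fun h => hy.ne' h.2, onReal, ENNReal.ofReal_div_of_pos (by exact_mod_cast hy),
    ENNReal.ofReal_coe_nnreal, ENNReal.ofReal_coe_nnreal]

lemma apply_zero_zero (hp : IsHomogeneousSuccess p γ) : p 0 0 = 1 / 2 := by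
  linarith [hp.add_eq_one 0 0]

lemma apply_zero_left (hp : IsHomogeneousSuccess p γ) {y : ℝ≥0} (hy : 0 < y) : p 0 y = 0 := by
  rw [hp.apply_of_pos 0 hy, NNReal.coe_zero, zero_div, hp.onReal_zero]

lemma apply_zero_right (hp : IsHomogeneousSuccess p γ) {x : ℝ≥0} (hx : 0 < x) : p x 0 = 1 := by
  linarith [hp.add_eq_one x 0, hp.apply_zero_left hx]

lemma apply_nonneg (hp : IsHomogeneousSuccess p γ) (x y : ℝ≥0) : 0 ≤ p x y := by
  by_cases h : x = 0 ∧ y = 0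
  · rw [h.1, h.2, hp.apply_zero_zero]
    norm_num
  · rw [hp.eq_ratio x y h]
    exact (hp.mem_unit _).1

lemma apply_zero_le (hp : IsHomogeneousSuccess p γ) (x y : ℝ≥0) : p 0 y ≤ p x y := by
  rcases (zero_le (a := y)).eq_or_lt with rfl | hy
  · rcases (zero_le (a := x)).eq_or_lt with rfl | hx
    · rfl
    · rw [hp.apply_zero_right hx, hp.apply_zero_zero]
      norm_num
  · rw [hp.apply_zero_left hy]
    exact hp.apply_nonneg x y

lemma eq_zero_of_stake_nonpos (hp : IsHomogeneousSuccess p γ) {a : ℝ} {x y : ℝ≥0}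
    (h : ∀ z, p z y * a - z ≤ p x y * a - x) (ha : a ≤ 0) : x = 0 := by
  have h1 := h 0
  have h2 := mul_le_mul_of_nonpos_right (hp.apply_zero_le x y) ha
  rw [NNReal.coe_zero] at h1
  exact le_antisymm (by exact_mod_cast (by linarith : (x : ℝ) ≤ 0)) zero_le

/-- Against an idle opponent a player with a positive stake has no best effort: arbitrarily small
positive efforts win for sure, but zero effort wins only with probability one half. -/
lemma ne_zero_of_stake_pos (hp : IsHomogeneousSuccess p γ) {a : ℝ} {x y : ℝ≥0}
    (h : ∀ z, p z y * a - z ≤ p x y * a - x) (ha : 0 < a) : y ≠ 0 := by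
  rintro rfl
  rcases (zero_le (a := x)).eq_or_lt with rfl | hx
  · have h1 := h (a / 4).toNNReal
    rw [hp.apply_zero_zero, hp.apply_zero_right (Real.toNNReal_pos.2 (by linarith)),
      Real.coe_toNNReal _ (by linarith), NNReal.coe_zero] at h1
    linarith
  · have h1 := h (x / 2)
    rw [hp.apply_zero_right hx, hp.apply_zero_right (half_pos hx)] at h1
    push_cast at h1
    have : (0 : ℝ) < x := by exact_mod_cast hx
    linarith

lemma deriv_mul_stake_eq (hp : IsHomogeneousSuccess p γ) {a : ℝ} {x y : ℝ≥0}
    (h : ∀ z, p z y * a - z ≤ p x y * a - x) (hx : 0 < x) (hy : 0 < y) :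
    deriv (onReal γ) (x / y) * a = y := by
  have hx' : (0 : ℝ) < x := by exact_mod_cast hx
  have hy' : (0 : ℝ) < y := by exact_mod_cast hy
  have h1 : HasDerivAt (fun s : ℝ => onReal γ (s / y) * a - s)
      (deriv (onReal γ) (x / y) * (1 / y) * a - 1) x := by
    have h2 : HasDerivAt (onReal γ) (deriv (onReal γ) (x / y)) ((x : ℝ) / y) :=
      (hp.differentiableAt_onReal (div_pos hx' hy')).hasDerivAt
    exact ((h2.comp (x : ℝ) ((hasDerivAt_id (x : ℝ)).div_const (y : ℝ))).mul_const a).sub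
      (hasDerivAt_id (x : ℝ))
  have h3 : IsLocalMax (fun s : ℝ => onReal γ (s / y) * a - s) x := by
    filter_upwards [eventually_gt_nhds hx'] with s hs
    have := h s.toNNReal
    rwa [hp.apply_of_pos _ hy, hp.apply_of_pos _ hy, Real.coe_toNNReal _ hs.le] at this
  have h4 := h3.hasDerivAt_eq_zero h1
  field_simp at h4
  linarith

end IsHomogeneousSuccess

@[simp] lemma Player.other_other (ℓ : Player) : ℓ.other.other = ℓ := by cases ℓ <;> rfl

/-- `c` is a pair of equilibrium payoffs of a single battle in which player `ℓ` receives `w ℓ` if he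
wins the battle and `l ℓ` if he loses it. -/
def IsBattleValue (p : ℝ≥0 → ℝ≥0 → ℝ) (w l c : Player → ℝ) : Prop :=
  ∃ x : Player → ℝ≥0, ∀ ℓ,
    c ℓ = l ℓ + p (x ℓ) (x ℓ.other) * (w ℓ - l ℓ) - x ℓ ∧
    ∀ y : ℝ≥0, l ℓ + p y (x ℓ.other) * (w ℓ - l ℓ) - y ≤ c ℓ

namespace IsBattleValue

variable {p : ℝ≥0 → ℝ≥0 → ℝ} {γ : ℝ≥0∞ → ℝ} {w l c : Player → ℝ}

/-- If one player has a positive stake, so has the other, and the effort ratio is the ratio of the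
stakes. -/
lemma eq_netShare (hp : IsHomogeneousSuccess p γ) (hc : IsBattleValue p w l c) {ℓ : Player}
    (h : 0 < w ℓ - l ℓ) :
    0 < w ℓ.other - l ℓ.other ∧
      c ℓ = l ℓ + netShare γ ((w ℓ - l ℓ) / (w ℓ.other - l ℓ.other)) * (w ℓ - l ℓ) ∧
      c ℓ.other = l ℓ.other + netShare γ ((w ℓ - l ℓ) / (w ℓ.other - l ℓ.other))⁻¹
        * (w ℓ.other - l ℓ.other) := by
  obtain ⟨x, hx⟩ := hc
  have best : ∀ ℓ z, p z (x ℓ.other) * (w ℓ - l ℓ) - z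
      ≤ p (x ℓ) (x ℓ.other) * (w ℓ - l ℓ) - x ℓ := fun ℓ z => by
    linarith [(hx ℓ).1, (hx ℓ).2 z]
  have best' := best ℓ.other
  have hy := hp.ne_zero_of_stake_pos (best ℓ) h
  have hb : 0 < w ℓ.other - l ℓ.other := by
    by_contra hb
    exact hy (hp.eq_zero_of_stake_nonpos best' (not_lt.1 hb))
  have hx0 := hp.ne_zero_of_stake_pos best' hb
  rw [Player.other_other] at best' hx0
  have hx1 := pos_iff_ne_zero.2 hx0
  have hy1 := pos_iff_ne_zero.2 hy
  have e1 := hp.deriv_mul_stake_eq (best ℓ) hx1 hy1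
  have e2 := hp.deriv_mul_stake_eq best' hy1 hx1
  have c1 := (hx ℓ).1
  have c2 := (hx ℓ.other).1
  rw [Player.other_other] at c2
  rw [hp.apply_of_pos _ hy1] at c1
  rw [hp.apply_of_pos _ hx1] at c2
  generalize w ℓ - l ℓ = a at *
  generalize w ℓ.other - l ℓ.other = b at *
  have X : (0 : ℝ) < x ℓ := by exact_mod_cast hx1
  have Y : (0 : ℝ) < x ℓ.other := by exact_mod_cast hy1
  have ht : (0 : ℝ) < x ℓ / x ℓ.other := div_pos X Y
  have hinv : (x ℓ.other : ℝ) / x ℓ = ((x ℓ : ℝ) / x ℓ.other)⁻¹ := (inv_div _ _).symm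
  have hxt : (x ℓ : ℝ) = (x ℓ / x ℓ.other : ℝ) * x ℓ.other := (div_mul_cancel₀ _ Y.ne').symm
  have hd := hp.deriv_onReal_pos ht
  have e3 := hp.deriv_onReal_inv ht
  rw [hinv] at e2 c2
  generalize hT : (x ℓ : ℝ) / x ℓ.other = t at *
  -- the two first-order conditions, together with `γ' (1 / t) = t² γ' t`, give `a = t * b`
  have hab : a = t * b := by
    rw [e3, hxt, ← e1] at e2
    have : t * deriv (onReal γ) t * (t * b - a) = 0 := by linarith
    rcases mul_eq_zero.1 this with h' | h'
    · exact absurd h' (mul_pos ht hd).ne'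
    · linarith
  have htab : a / b = t := by rw [hab, mul_div_cancel_right₀ _ hb.ne']
  refine ⟨hb, ?_, ?_⟩
  · rw [c1, htab, netShare, hxt, ← e1]
    ring
  · rw [c2, htab, netShare, e3]
    have : (x ℓ.other : ℝ) = t⁻¹ * (t ^ 2 * deriv (onReal γ) t) * b := by
      rw [← e1, hab]
      field_simp
    rw [this]
    ring

/-- If one player has no positive stake, then nobody exerts effort and the battle is decided by a
fair draw. -/
lemma eq_average (hp : IsHomogeneousSuccess p γ) (hc : IsBattleValue p w l c) {ℓ : Player}
    (h : w ℓ - l ℓ ≤ 0) :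
    c ℓ = (w ℓ + l ℓ) / 2 ∧ c ℓ.other = (w ℓ.other + l ℓ.other) / 2 := by
  have h' : w ℓ.other - l ℓ.other ≤ 0 := by
    by_contra hb
    have := (hc.eq_netShare hp (not_le.1 hb)).1
    rw [Player.other_other] at this
    linarith
  obtain ⟨x, hx⟩ := hc
  have best : ∀ ℓ z, p z (x ℓ.other) * (w ℓ - l ℓ) - z
      ≤ p (x ℓ) (x ℓ.other) * (w ℓ - l ℓ) - x ℓ := fun ℓ z => by
    linarith [(hx ℓ).1, (hx ℓ).2 z]
  have h1 := hp.eq_zero_of_stake_nonpos (best ℓ) h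
  have h2 := hp.eq_zero_of_stake_nonpos (best ℓ.other) h'
  have c1 := (hx ℓ).1
  have c2 := (hx ℓ.other).1
  rw [Player.other_other] at c2
  rw [h1, h2, hp.apply_zero_zero, NNReal.coe_zero] at c1 c2
  constructor <;> linarith

lemma unique (hp : IsHomogeneousSuccess p γ) {c' : Player → ℝ} (hc : IsBattleValue p w l c)
    (hc' : IsBattleValue p w l c') : c = c' := by
  funext ℓ
  rcases lt_or_ge 0 (w ℓ - l ℓ) with h | h
  · rw [(hc.eq_netShare hp h).2.1, (hc'.eq_netShare hp h).2.1]
  · rw [(hc.eq_average hp h).1, (hc'.eq_average hp h).1]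

lemma bounds (hp : IsHomogeneousSuccess p γ) (hc : IsBattleValue p w l c) {ℓ : Player}
    (h : l ℓ < w ℓ) :
    l ℓ ≤ c ℓ ∧ c ℓ < w ℓ ∧ l ℓ.other ≤ c ℓ.other ∧ c ℓ.other < w ℓ.other := by
  obtain ⟨hb, h1, h2⟩ := hc.eq_netShare hp (sub_pos.2 h)
  have ha := sub_pos.2 h
  have ht := div_pos ha hb
  have ht' := inv_pos.2 ht
  have k1 := mul_nonneg (hp.netShare_nonneg ht) ha.le
  have k2 := mul_nonneg (hp.netShare_nonneg ht') hb.le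
  have k3 := mul_lt_mul_of_pos_right (hp.netShare_lt_one ht) ha
  have k4 := mul_lt_mul_of_pos_right (hp.netShare_lt_one ht') hb
  refine ⟨?_, ?_, ?_, ?_⟩ <;> linarith

lemma eq_of_equal_stakes (hp : IsHomogeneousSuccess p γ) (hc : IsBattleValue p w l c) {ℓ : Player}
    (h : l ℓ < w ℓ) (h' : w ℓ.other - l ℓ.other = w ℓ - l ℓ) :
    c ℓ = l ℓ + netShare γ 1 * (w ℓ - l ℓ) := by
  have := (hc.eq_netShare hp (sub_pos.2 h)).2.1
  rwa [h', div_self (sub_pos.2 h).ne'] at this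

/-- What player `ℓ` falls short of his victory payoff is bounded linearly by what he gains over his
defeat payoff, with a coefficient below one, and by what the opponent falls short of.  If the stake
of `ℓ` dominates, his net share is above one half and the first term suffices; otherwise the
shortfall of the opponent is comparable to his own stake, hence to that of `ℓ`. -/
lemma sub_le (hp : IsHomogeneousSuccess p γ) {s : ℝ} (hs : 0 < s)
    (hs' : ∀ t, s ≤ t → 5 / 8 ≤ netShare γ t) (hc : IsBattleValue p w l c) {ℓ : Player}
    (h : l ℓ < w ℓ) :
    w ℓ - c ℓ ≤ 3 / 5 * (c ℓ - l ℓ) + 2 * s * (w ℓ.other - c ℓ.other) := by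
  obtain ⟨hb, h1, h2⟩ := hc.eq_netShare hp (sub_pos.2 h)
  have ha := sub_pos.2 h
  have ht := div_pos ha hb
  have ht' := inv_pos.2 ht
  have hab : w ℓ - l ℓ = (w ℓ - l ℓ) / (w ℓ.other - l ℓ.other) * (w ℓ.other - l ℓ.other) :=
    (div_mul_cancel₀ _ hb.ne').symm
  have e1 : w ℓ - c ℓ = (w ℓ - l ℓ) - (c ℓ - l ℓ) := by ring
  have e2 : w ℓ.other - c ℓ.other = (w ℓ.other - l ℓ.other) - (c ℓ.other - l ℓ.other) := by ring
  have e3 := sub_eq_iff_eq_add'.2 h1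
  have e4 := sub_eq_iff_eq_add'.2 h2
  rw [e1, e2, e3, e4]
  generalize w ℓ - l ℓ = a at *
  generalize w ℓ.other - l ℓ.other = b at *
  generalize a / b = t at *
  have k0 := mul_nonneg (hp.netShare_nonneg ht) ha.le
  have k1 := mul_nonneg (sub_nonneg.2 (hp.netShare_lt_one ht').le) hb.le
  rcases le_total s t with hst | hst
  · have k2 := mul_le_mul_of_nonneg_right (hs' t hst) ha.le
    have k3 := mul_nonneg (mul_pos two_pos hs).le k1
    linarith
  · have hs2 : 1 / 2 ≤ onReal γ s := by
      linarith [hs' s le_rfl, hp.netShare_lt_onReal hs]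
    have k2 := mul_le_mul_of_nonneg_right (hp.one_sub_netShare_mul_le hs hs2 ht hst) hb.le
    have k3 : (1 - netShare γ t) * t * b = a - netShare γ t * a := by rw [hab]; ring
    linarith

end IsBattleValue

/-! ### The payoffs along streaks -/

/-- The relations between the equilibrium payoffs along winning streaks from the start: `f k i` is
the payoff in the `k`-th contest of a player who has won the first `i` battles, and `g k i` that of
his opponent.  A streak of `N k` wins ends the `k`-th contest, and a loss after `i + 1` wins in the
`k + 1`-st contest leads to the situation after `i` wins in the `k`-th one. -/
structure IsStreakValue (p : ℝ≥0 → ℝ≥0 → ℝ) (v : ℝ) (N : ℕ → ℕ) (f g : ℕ → ℕ → ℝ) : Prop where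
  zero_eq_one : N 0 = 1
  two_le : ∀ k, 2 ≤ N (k + 1)
  leader_of_le : ∀ k i, N k ≤ i → f k i = v
  trailer_of_le : ∀ k i, N k ≤ i → g k i = 0
  start_eq : ∀ k, g k 0 = f k 0
  start : ∀ k, IsBattleValue p (fun _ => f k 1) (fun _ => g k 1) (fun _ => f k 0)
  step : ∀ k i, i + 1 < N (k + 1) → IsBattleValue p
    (fun ℓ => if ℓ = .A then f (k + 1) (i + 2) else g k i)
    (fun ℓ => if ℓ = .A then f k i else g (k + 1) (i + 2))
    (fun ℓ => if ℓ = .A then f (k + 1) (i + 1) else g (k + 1) (i + 1))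

/-- Payoffs along streaks are monotone up to the effective length `n` of a decisive streak. -/
structure IsMonotoneStreak (v : ℝ) (n : ℕ) (f g : ℕ → ℝ) : Prop where
  one_le : 1 ≤ n
  leader_lt : ∀ i, i < n → f i < f (i + 1)
  trailer_le : ∀ i, i < n → g (i + 1) ≤ g i
  leader_of_le : ∀ i, n ≤ i → f i = v
  trailer_of_le : ∀ i, n ≤ i → g i = 0

namespace IsMonotoneStreak

variable {v : ℝ} {n : ℕ} {f g : ℕ → ℝ}

lemma monotone (h : IsMonotoneStreak v n f g) : Monotone f :=
  monotone_nat_of_le_succ fun i => by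
    rcases lt_or_ge i n with hi | hi
    · exact (h.leader_lt i hi).le
    · rw [h.leader_of_le i hi, h.leader_of_le _ (hi.trans (Nat.le_succ i))]

lemma antitone (h : IsMonotoneStreak v n f g) : Antitone g :=
  antitone_nat_of_succ_le fun i => by
    rcases lt_or_ge i n with hi | hi
    · exact h.trailer_le i hi
    · rw [h.trailer_of_le i hi, h.trailer_of_le _ (hi.trans (Nat.le_succ i))]

lemma leader_le (h : IsMonotoneStreak v n f g) (i : ℕ) : f i ≤ v :=
  (h.monotone (le_max_left i n)).trans_eq (h.leader_of_le _ (le_max_right i n))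

lemma trailer_nonneg (h : IsMonotoneStreak v n f g) (i : ℕ) : 0 ≤ g i :=
  (h.trailer_of_le _ (le_max_right i n)).symm.trans_le (h.antitone (le_max_left i n))

end IsMonotoneStreak

namespace IsStreakValue

variable {p : ℝ≥0 → ℝ≥0 → ℝ} {γ : ℝ≥0∞ → ℝ} {v : ℝ} {N : ℕ → ℕ} {f g : ℕ → ℕ → ℝ}

/-- The payoff at the start, given that the first win is worth more than the first loss. -/
lemma start_payoff (hp : IsHomogeneousSuccess p γ) (h : IsStreakValue p v N f g) {k : ℕ}
    (hk : g k 1 < f k 1) : f k 0 = g k 1 + netShare γ 1 * (f k 1 - g k 1) :=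
  (h.start k).eq_of_equal_stakes hp (ℓ := .A) hk rfl

lemma lt_and_le_of_start (hp : IsHomogeneousSuccess p γ) (h : IsStreakValue p v N f g) {k : ℕ}
    (hk : g k 1 < f k 1) : f k 0 < f k 1 ∧ g k 1 ≤ g k 0 := by
  have h1 := (h.start k).bounds hp (ℓ := .A) hk
  exact ⟨h1.2.1, (h.start_eq k).symm ▸ h1.1⟩

/-- If a streak of `n` wins is decisive in the previous contest, then nothing is at stake after more
than `n` wins: even a loss leaves the leader with the whole prize. -/
lemma step_of_le (hp : IsHomogeneousSuccess p γ) (h : IsStreakValue p v N f g) {k n : ℕ}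
    (hn : IsMonotoneStreak v n (f k) (g k)) (i : ℕ) (hi : min (N (k + 1)) (n + 1) ≤ i) :
    f (k + 1) i = v ∧ g (k + 1) i = 0 := by
  induction hj : N (k + 1) - i generalizing i with
  | zero =>
    have hi' : N (k + 1) ≤ i := by omega
    exact ⟨h.leader_of_le _ _ hi', h.trailer_of_le _ _ hi'⟩
  | succ j ih =>
    obtain ⟨m, rfl⟩ : ∃ m, i = m + 1 := ⟨i - 1, by omega⟩
    obtain ⟨h1, h2⟩ := ih (m + 2) (by omega) (by omega)
    have h3 := hn.leader_of_le m (by omega)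
    have h4 := hn.trailer_of_le m (by omega)
    have h5 := (h.step k m (by omega)).eq_average hp (ℓ := .A) (by simp [h1, h3])
    simp only [Player.other, reduceCtorEq, if_true, if_false, h1, h2, h3, h4] at h5
    constructor <;> linarith

lemma step_bounds (hp : IsHomogeneousSuccess p γ) (h : IsStreakValue p v N f g) {k i : ℕ}
    (hi : i + 1 < N (k + 1)) (hlt : f k i < f (k + 1) (i + 2)) :
    f k i ≤ f (k + 1) (i + 1) ∧ f (k + 1) (i + 1) < f (k + 1) (i + 2) ∧
      g (k + 1) (i + 2) ≤ g (k + 1) (i + 1) ∧ g (k + 1) (i + 1) < g k i := by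
  simpa [Player.other] using (h.step k i hi).bounds hp (ℓ := .A) (by simpa using hlt)

/-- The stake of the leader is positive: after one more win he is better off than after a loss,
which takes him back to the lead `i` in the previous contest. -/
lemma leader_lt_leader (hp : IsHomogeneousSuccess p γ) (h : IsStreakValue p v N f g) {k n : ℕ}
    (hn : IsMonotoneStreak v n (f k) (g k)) (i : ℕ) (hi : i + 1 < min (N (k + 1)) (n + 1)) :
    f k i < f (k + 1) (i + 2) := by
  induction hj : n - i generalizing i with
  | zero => omega
  | succ j ih =>
    refine (hn.leader_lt i (by omega)).trans_le ?_
    by_cases hi' : i + 2 < min (N (k + 1)) (n + 1)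
    · exact (h.step_bounds hp (by omega) (ih (i + 1) hi' (by omega))).1
    · rw [(h.step_of_le hp hn (i + 2) (by omega)).1]
      exact hn.leader_le _

lemma isMonotoneStreak_succ (hp : IsHomogeneousSuccess p γ) (h : IsStreakValue p v N f g) {k n : ℕ}
    (hn : IsMonotoneStreak v n (f k) (g k)) :
    IsMonotoneStreak v (min (N (k + 1)) (n + 1)) (f (k + 1)) (g (k + 1)) := by
  have hN := h.two_le k
  have hn1 := hn.one_le
  have key : ∀ i, i + 1 < min (N (k + 1)) (n + 1) → _ := fun i hi =>
    h.step_bounds hp (by omega) (h.leader_lt_leader hp hn i hi)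
  have h0 : g (k + 1) 1 < f (k + 1) 1 := by
    obtain ⟨k1, -, -, k4⟩ := key 0 (by omega)
    exact k4.trans_le ((h.start_eq k).trans_le k1)
  refine ⟨by omega, ?_, ?_, fun i hi => (h.step_of_le hp hn i hi).1,
    fun i hi => (h.step_of_le hp hn i hi).2⟩
  · rintro (_ | i) hi
    · exact (h.lt_and_le_of_start hp h0).1
    · exact (key i hi).2.1
  · rintro (_ | i) hi
    · exact (h.lt_and_le_of_start hp h0).2
    · exact (key i hi).2.2.1

lemma exists_isMonotoneStreak (hp : IsHomogeneousSuccess p γ) (hv : 0 < v)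
    (h : IsStreakValue p v N f g) (k : ℕ) :
    ∃ n ≤ k + 1, IsMonotoneStreak v n (f k) (g k) := by
  induction k with
  | zero =>
    have hf : ∀ i, 1 ≤ i → f 0 i = v := fun i hi => h.leader_of_le 0 i (h.zero_eq_one.trans_le hi)
    have hg : ∀ i, 1 ≤ i → g 0 i = 0 := fun i hi => h.trailer_of_le 0 i (h.zero_eq_one.trans_le hi)
    have h0 := h.lt_and_le_of_start hp (k := 0) (by rwa [hf 1 le_rfl, hg 1 le_rfl])
    refine ⟨1, le_rfl, le_rfl, fun i hi => ?_, fun i hi => ?_, hf, hg⟩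
    · obtain rfl : i = 0 := by omega
      exact h0.1
    · obtain rfl : i = 0 := by omega
      exact h0.2
  | succ k ih =>
    obtain ⟨n, hn, hm⟩ := ih
    exact ⟨_, by omega, h.isMonotoneStreak_succ hp hm⟩

lemma step_le (hp : IsHomogeneousSuccess p γ) (hv : 0 < v) (h : IsStreakValue p v N f g) {s : ℝ}
    (hs : 0 < s) (hs' : ∀ t, s ≤ t → 5 / 8 ≤ netShare γ t) (k i : ℕ) :
    f (k + 1) (i + 2) - f (k + 1) (i + 1) ≤
      3 / 5 * (f (k + 1) (i + 1) - f k i) + 2 * s * (g k i - g (k + 1) (i + 1)) := by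
  obtain ⟨n, -, hn⟩ := h.exists_isMonotoneStreak hp hv k
  by_cases hi : i + 1 < min (N (k + 1)) (n + 1)
  · simpa [Player.other] using (h.step k i (by omega)).sub_le hp hs hs' (ℓ := .A)
      (by simpa using h.leader_lt_leader hp hn i hi)
  · obtain ⟨h1, h2⟩ := h.step_of_le hp hn (i + 1) (by omega)
    rw [(h.step_of_le hp hn (i + 2) (by omega)).1, h1, h2]
    have h3 := hn.leader_le i
    have h4 := mul_nonneg (mul_pos two_pos hs).le (hn.trailer_nonneg i)
    linarith

/-- The potential of a contest: a weighted sum over streaks, cut off at length `m`, of the shortfall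
of the leader from the prize and of the payoff of the trailing player. -/
noncomputable def potential (v s : ℝ) (f g : ℕ → ℝ) (m : ℕ) : ℝ :=
  3 / 5 * ∑ i ∈ Finset.range m, (v - f i) + 2 * s * ∑ i ∈ Finset.range m, g i

/-- The bound for single battles, summed along the streaks: the decrease of the potential makes up
for a low payoff at the start. -/
lemma prize_le (hp : IsHomogeneousSuccess p γ) (hv : 0 < v) (h : IsStreakValue p v N f g) {s : ℝ}
    (hs : 0 < s) (hs' : ∀ t, s ≤ t → 5 / 8 ≤ netShare γ t) {k m : ℕ} (hm : k + 1 ≤ m) :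
    2 / 5 * v ≤ (1 / netShare γ 1 + 2 * s) * f (k + 1) 0
      + potential v s (f k) (g k) m - potential v s (f (k + 1)) (g (k + 1)) m := by
  obtain ⟨n, hnk, hn⟩ := h.exists_isMonotoneStreak hp hv k
  obtain ⟨n', hnk', hn'⟩ := h.exists_isMonotoneStreak hp hv (k + 1)
  have h1 : f (k + 1) (m + 1) - f (k + 1) 1 ≤
      3 / 5 * (∑ i ∈ Finset.range m, f (k + 1) (i + 1) - ∑ i ∈ Finset.range m, f k i)
      + 2 * s * (∑ i ∈ Finset.range m, g k i - ∑ i ∈ Finset.range m, g (k + 1) (i + 1)) := by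
    rw [← Finset.sum_range_sub (fun i => f (k + 1) (i + 1)) m, ← Finset.sum_sub_distrib,
      ← Finset.sum_sub_distrib, Finset.mul_sum, Finset.mul_sum, ← Finset.sum_add_distrib]
    exact Finset.sum_le_sum fun i _ => h.step_le hp hv hs hs' k i
  have shift : ∀ u : ℕ → ℝ, ∑ i ∈ Finset.range m, u (i + 1)
      = ∑ i ∈ Finset.range m, u i + u m - u 0 := fun u => by
    have := Finset.sum_range_succ u m
    rw [Finset.sum_range_succ'] at this
    linarith
  have h2 : netShare γ 1 * f (k + 1) 1 ≤ f (k + 1) 0 := by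
    have hlt : g (k + 1) 1 < f (k + 1) 1 := by
      have := hn'.leader_lt 0 hn'.one_le
      have h3 := hn'.trailer_le 0 hn'.one_le
      rw [h.start_eq] at h3
      exact h3.trans_lt this
    have h4 := mul_nonneg (sub_nonneg.2 (hp.netShare_lt_one one_pos).le) (hn'.trailer_nonneg 1)
    linarith [h.start_payoff hp hlt]
  have h3 : f (k + 1) 1 ≤ 1 / netShare γ 1 * f (k + 1) 0 := by
    rw [one_div_mul_eq_div, le_div_iff₀ hp.netShare_one_pos, mul_comm]
    exact h2
  have hfm : f (k + 1) m ≤ v := hn'.leader_le m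
  have hgm : 0 ≤ g (k + 1) m := hn'.trailer_nonneg m
  have hf0 : 0 ≤ f (k + 1) 0 := (h.start_eq (k + 1)) ▸ hn'.trailer_nonneg 0
  rw [shift, shift, h.start_eq, hn'.leader_of_le (m + 1) (by omega)] at h1
  simp only [potential, Finset.sum_sub_distrib]
  have := mul_nonneg hs.le hgm
  linarith

/-- The average payoff at the start of the first contests stays bounded away from zero. -/
lemma mul_le_sum (hp : IsHomogeneousSuccess p γ) (hv : 0 < v) (h : IsStreakValue p v N f g) {s : ℝ}
    (hs : 0 < s) (hs' : ∀ t, s ≤ t → 5 / 8 ≤ netShare γ t) (m : ℕ) :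
    2 / 5 * v * m ≤ (1 / netShare γ 1 + 2 * s) * ∑ k ∈ Finset.range m, f (k + 1) 0
      + (3 / 5 * (v - f 0 0) + 2 * s * g 0 0) := by
  have h1 : ∑ k ∈ Finset.range m, (2 / 5 * v) ≤ ∑ k ∈ Finset.range m,
      ((1 / netShare γ 1 + 2 * s) * f (k + 1) 0 - (potential v s (f (k + 1)) (g (k + 1)) (m + 1)
        - potential v s (f k) (g k) (m + 1))) :=
    Finset.sum_le_sum fun k hk => by
      have := h.prize_le hp hv hs hs' (k := k) (m := m + 1)
        (by have := Finset.mem_range.1 hk; omega)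
      linarith
  rw [Finset.sum_const, Finset.card_range, nsmul_eq_mul, Finset.sum_sub_distrib, ← Finset.mul_sum,
    Finset.sum_range_sub (fun k => potential v s (f k) (g k) (m + 1))] at h1
  have h2 : potential v s (f 0) (g 0) (m + 1) = 3 / 5 * (v - f 0 0) + 2 * s * g 0 0 := by
    have hf : ∀ i, f 0 (i + 1) = v := fun i =>
      h.leader_of_le 0 _ (h.zero_eq_one.trans_le (Nat.le_add_left 1 i))
    have hg : ∀ i, g 0 (i + 1) = 0 := fun i =>
      h.trailer_of_le 0 _ (h.zero_eq_one.trans_le (Nat.le_add_left 1 i))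
    simp [potential, Finset.sum_range_succ', hf, hg, -Finset.sum_sub_distrib]
  have h3 : 0 ≤ potential v s (f m) (g m) (m + 1) := by
    obtain ⟨n, -, hn⟩ := h.exists_isMonotoneStreak hp hv m
    have k1 := Finset.sum_nonneg fun i (_ : i ∈ Finset.range (m + 1)) =>
      sub_nonneg.2 (hn.leader_le i)
    have k2 := Finset.sum_nonneg fun i (_ : i ∈ Finset.range (m + 1)) => hn.trailer_nonneg i
    have := mul_nonneg hs.le k2
    rw [potential]
    linarith
  linarith

lemma le_limit (hp : IsHomogeneousSuccess p γ) (hv : 0 < v) (h : IsStreakValue p v N f g) {s : ℝ}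
    (hs : 0 < s) (hs' : ∀ t, s ≤ t → 5 / 8 ≤ netShare γ t) {L : ℝ}
    (hL : Tendsto (fun k => f k 0) atTop (𝓝 L)) :
    2 / 5 * v ≤ (1 / netShare γ 1 + 2 * s) * L := by
  have h1 := (((tendsto_add_atTop_iff_nat 1).2 hL).cesaro.const_mul
    (1 / netShare γ 1 + 2 * s)).add
    (tendsto_inv_atTop_nhds_zero_nat (𝕜 := ℝ) |>.mul_const (3 / 5 * (v - f 0 0) + 2 * s * g 0 0))
  rw [zero_mul, add_zero] at h1
  refine ge_of_tendsto h1 ((eventually_gt_atTop 0).mono fun m hm => ?_)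
  have hm' : (0 : ℝ) < m := by exact_mod_cast hm
  have h2 := mul_le_mul_of_nonneg_right (h.mul_le_sum hp hv hs hs' m) (inv_pos.2 hm').le
  rw [mul_assoc (2 / 5 * v), mul_inv_cancel₀ hm'.ne', mul_one] at h2
  linarith

end IsStreakValue

/-! ### Payoffs in contests of bounded length -/

lemma Player.eq_or_eq_other (ℓ ℓ' : Player) : ℓ' = ℓ ∨ ℓ' = ℓ.other := by
  cases ℓ <;> cases ℓ' <;> simp [Player.other]

lemma Player.other_ne (ℓ : Player) : ℓ.other ≠ ℓ := by cases ℓ <;> simp [Player.other]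

lemma tsum_list_player (F : List Player → ℝ≥0∞) (ℓ : Player) :
    ∑' w, F w = F [] + (∑' w, F (ℓ :: w) + ∑' w, F (ℓ.other :: w)) := by
  have h1 : ∀ w, F w = (if w = [] then F w else 0) +
      ((if w.head? = some ℓ then F w else 0) + (if w.head? = some ℓ.other then F w else 0)) := by
    rintro (_ | ⟨ℓ', w⟩)
    · simp
    · rcases ℓ.eq_or_eq_other ℓ' with rfl | rfl
      · simp [ℓ'.other_ne.symm]
      · simp [ℓ.other_ne]
  have h2 : ∀ ℓ' : Player, ∑' w : List Player, (if w.head? = some ℓ' then F w else 0)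
      = ∑' w, F (ℓ' :: w) := fun ℓ' => by
    rw [← (List.cons_injective (a := ℓ')).tsum_eq]
    · simp
    · rintro (_ | ⟨ℓ₁, w⟩) hw
      · simp at hw
      · have : ℓ₁ = ℓ' := by
          by_contra hne
          simp [hne] at hw
        exact ⟨w, by rw [this]⟩
  have h3 : ∑' w : List Player, (if w = [] then F w else 0) = F [] := by
    rw [tsum_eq_single []]
    · simp
    · intro w hw
      simp [hw]
  rw [tsum_congr h1, ENNReal.tsum_add, ENNReal.tsum_add, h2, h2, h3]

/-- The expected total of `φ` over all histories that extend `h`, weighted by the probability of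
reaching them from `h`. -/
noncomputable def expectedTotal (p : ℝ≥0 → ℝ≥0 → ℝ) (σ : Profile) (φ : List Player → ℝ≥0∞)
    (h : List Player) : ℝ≥0∞ :=
  ∑' w, reachProb p σ h w * φ (h ++ w)

section expectedTotal

variable {p : ℝ≥0 → ℝ≥0 → ℝ} {σ : Profile} {φ : List Player → ℝ≥0∞}

lemma expectedTotal_eq (h : List Player) (ℓ : Player) :
    expectedTotal p σ φ h = φ h +
      (ENNReal.ofReal (p (σ ℓ h) (σ ℓ.other h)) * expectedTotal p σ φ (h ++ [ℓ]) +
      ENNReal.ofReal (p (σ ℓ.other h) (σ ℓ h)) * expectedTotal p σ φ (h ++ [ℓ.other])) := by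
  simp only [expectedTotal]
  rw [tsum_list_player _ ℓ, ← ENNReal.tsum_mul_left, ← ENNReal.tsum_mul_left]
  simp [reachProb, mul_assoc]

lemma expectedTotal_of_forall_eq_zero {h : List Player} (hφ : ∀ w, w ≠ [] → φ (h ++ w) = 0) :
    expectedTotal p σ φ h = φ h := by
  rw [expectedTotal, tsum_eq_single []]
  · simp [reachProb]
  · intro w hw
    rw [hφ w hw, mul_zero]

lemma expectedTotal_ne_top {d : ℕ} (hφ : ∀ h, φ h ≠ ⊤) (hd : ∀ h, d < h.length → φ h = 0)
    (h : List Player) : expectedTotal p σ φ h ≠ ⊤ := by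
  induction hn : d - h.length generalizing h with
  | zero =>
    rw [expectedTotal_of_forall_eq_zero]
    · exact hφ h
    · intro w hw
      apply hd
      have := List.length_pos_iff.2 hw
      rw [List.length_append]
      omega
  | succ n ih =>
    have key : ∀ ℓ, expectedTotal p σ φ (h ++ [ℓ]) ≠ ⊤ := fun ℓ =>
      ih _ (by rw [List.length_append, List.length_singleton]; omega)
    rw [expectedTotal_eq h .A]
    exact ENNReal.add_ne_top.2 ⟨hφ h, ENNReal.add_ne_top.2
      ⟨ENNReal.mul_ne_top ENNReal.ofReal_ne_top (key _),
      ENNReal.mul_ne_top ENNReal.ofReal_ne_top (key _)⟩⟩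

lemma reachProb_congr {σ' : Profile} {h : List Player} (hσ : ∀ ℓ w, σ ℓ (h ++ w) = σ' ℓ (h ++ w))
    (w : List Player) : reachProb p σ h w = reachProb p σ' h w := by
  induction w generalizing h with
  | nil => rfl
  | cons ℓ w ih =>
    rw [reachProb, reachProb, ih fun ℓ w => by simpa using hσ ℓ (_ :: w)]
    have := fun ℓ => hσ ℓ []
    simp only [List.append_nil] at this
    rw [this, this]

lemma expectedTotal_congr {σ' : Profile} {φ' : List Player → ℝ≥0∞} {h : List Player}
    (hσ : ∀ ℓ w, σ ℓ (h ++ w) = σ' ℓ (h ++ w)) (hφ : ∀ w, φ (h ++ w) = φ' (h ++ w)) :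
    expectedTotal p σ φ h = expectedTotal p σ' φ' h :=
  tsum_congr fun w => by rw [reachProb_congr hσ, hφ]

end expectedTotal

namespace Contest

variable {M M' : Contest} {p : ℝ≥0 → ℝ≥0 → ℝ} {γ : ℝ≥0∞ → ℝ} {v : ℝ} {σ : Profile}
  {u u' : Player → List Player → ℝ} {h : List Player} {d : ℕ}

lemma isHistory_nil : M.IsHistory [] := fun _ hg hne => absurd (List.prefix_nil.1 hg) hne

lemma isLive_nil : M.IsLive [] := ⟨isHistory_nil, M.outcome_nil⟩

lemma IsLive.isHistory_append (hh : M.IsLive h) (ℓ : Player) : M.IsHistory (h ++ [ℓ]) := by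
  intro g hg hne
  rcases List.prefix_concat_iff.1 hg with rfl | hg
  · exact absurd rfl hne
  · by_cases hgh : g = h
    · rw [hgh, hh.2]
    · exact hh.1 g hg hgh

lemma isHistory_of_outcome_ne_none (hh : M.outcome h ≠ none) : M.IsHistory h := by
  rintro g ⟨w, rfl⟩ hne
  by_contra hg
  exact hh (M.no_redundancy g w hg fun hw => hne (by simp [hw]))

lemma not_isLive_append {w : List Player} (hh : M.outcome h ≠ none) : ¬ M.IsLive (h ++ w) := by
  intro hw
  by_cases hw' : w = []
  · rw [hw', List.append_nil] at hw
    exact hh hw.2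
  · exact hh (hw.1 h (List.prefix_append h w) (by simpa using hw'))

/-- All battles are fought after fewer than `d` earlier ones. -/
def HasDepth (M : Contest) (d : ℕ) : Prop := ∀ h, M.IsLive h → h.length < d

lemma HasDepth.length_le (hd : M.HasDepth d) (hh : M.outcome h ≠ none) : h.length ≤ d := by
  rcases List.eq_nil_or_concat h with rfl | ⟨g, ℓ, rfl⟩
  · exact Nat.zero_le d
  · rw [List.concat_eq_append] at hh ⊢
    have hg : M.outcome g = none := by
      by_contra hg
      exact hh (M.no_redundancy g [ℓ] hg (by simp))
    have hlive : M.IsLive g := ⟨fun g' hg' hne =>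
      isHistory_of_outcome_ne_none hh g' (hg'.trans (List.prefix_append g [ℓ])) fun h' => by
        rw [h'] at hg'
        have := hg'.length_le
        simp at this, hg⟩
    have := hd g hlive
    rw [List.length_append, List.length_singleton]
    omega

lemma winProb_eq (ℓ : Player) (h : List Player) :
    M.winProb p σ ℓ h = expectedTotal p σ (fun h => if M.outcome h = some ℓ then 1 else 0) h :=
  tsum_congr fun w => by simp

open Classical in
lemma expectedEffort_eq (ℓ : Player) (h : List Player) : M.expectedEffort p σ ℓ h =
    expectedTotal p σ (fun h => if M.IsLive h then (σ ℓ h : ℝ≥0∞) else 0) h :=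
  tsum_congr fun w => by simp

lemma HasDepth.winProb_ne_top (hd : M.HasDepth d) (ℓ : Player) (h : List Player) :
    M.winProb p σ ℓ h ≠ ⊤ := by
  rw [winProb_eq]
  refine expectedTotal_ne_top (d := d) (fun h => ?_) (fun h hh => ?_) h
  · split_ifs <;> simp
  · refine if_neg fun h1 => ?_
    exact absurd (hd.length_le (h1 ▸ Option.some_ne_none ℓ)) (not_le.2 hh)

lemma HasDepth.expectedEffort_ne_top (hd : M.HasDepth d) (ℓ : Player) (h : List Player) :
    M.expectedEffort p σ ℓ h ≠ ⊤ := by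
  rw [expectedEffort_eq]
  refine expectedTotal_ne_top (d := d) (fun h => ?_) (fun h hh => ?_) h
  · split_ifs <;> simp
  · exact if_neg fun h1 => absurd (hd h h1) (not_lt.2 hh.le)

/-- The payoff as a real number; it agrees with `Contest.payoff` when the expected effort is
finite. -/
noncomputable def realPayoff (M : Contest) (p : ℝ≥0 → ℝ≥0 → ℝ) (v : ℝ) (σ : Profile) (ℓ : Player)
    (h : List Player) : ℝ :=
  v * (M.winProb p σ ℓ h).toReal
    + v / 2 * (1 - (M.winProb p σ ℓ h).toReal - (M.winProb p σ ℓ.other h).toReal)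
    - (M.expectedEffort p σ ℓ h).toReal

lemma HasDepth.payoff_eq (hd : M.HasDepth d) (ℓ : Player) (h : List Player) :
    M.payoff p v σ ℓ h = (M.realPayoff p v σ ℓ h : ℝ) := by
  rw [payoff, realPayoff, ← EReal.coe_ennreal_toReal (hd.expectedEffort_ne_top ℓ h),
    EReal.coe_sub]

lemma realPayoff_congr {σ' : Profile} (hσ : ∀ ℓ w, σ ℓ (h ++ w) = σ' ℓ (h ++ w)) (ℓ : Player) :
    M.realPayoff p v σ ℓ h = M.realPayoff p v σ' ℓ h := by
  have he : M.expectedEffort p σ ℓ h = M.expectedEffort p σ' ℓ h := by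
    rw [expectedEffort_eq, expectedEffort_eq]
    exact expectedTotal_congr hσ fun w => by rw [hσ]
  simp only [realPayoff, winProb_eq, he]
  rw [expectedTotal_congr hσ fun _ => rfl, expectedTotal_congr hσ fun _ => rfl]

lemma realPayoff_of_outcome {ℓ : Player} (hh : M.outcome h = some ℓ) :
    M.realPayoff p v σ ℓ h = v ∧ M.realPayoff p v σ ℓ.other h = 0 := by
  have hne : M.outcome h ≠ none := hh ▸ Option.some_ne_none ℓ
  have h1 : ∀ ℓ', M.winProb p σ ℓ' h = if ℓ = ℓ' then 1 else 0 := fun ℓ' => by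
    rw [winProb_eq, expectedTotal_of_forall_eq_zero]
    · simp [hh]
    · intro w hw
      simp [M.no_redundancy h w hne hw]
  have h2 : ∀ ℓ', M.expectedEffort p σ ℓ' h = 0 := fun ℓ' => by
    rw [expectedEffort_eq, expectedTotal_of_forall_eq_zero]
    · exact if_neg fun h' => hne h'.2
    · exact fun w _ => if_neg (not_isLive_append hne)
  simp [realPayoff, h1, h2, ℓ.other_ne.symm]

lemma HasDepth.realPayoff_of_isLive (hd : M.HasDepth d) (hp : IsHomogeneousSuccess p γ)
    (hh : M.IsLive h) (ℓ : Player) :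
    M.realPayoff p v σ ℓ h = M.realPayoff p v σ ℓ (h ++ [ℓ.other]) + p (σ ℓ h) (σ ℓ.other h) *
      (M.realPayoff p v σ ℓ (h ++ [ℓ]) - M.realPayoff p v σ ℓ (h ++ [ℓ.other])) - σ ℓ h := by
  have hw : ∀ ℓ', (M.winProb p σ ℓ' h).toReal =
      p (σ ℓ h) (σ ℓ.other h) * (M.winProb p σ ℓ' (h ++ [ℓ])).toReal +
      p (σ ℓ.other h) (σ ℓ h) * (M.winProb p σ ℓ' (h ++ [ℓ.other])).toReal := fun ℓ' => by
    have h1 := hd.winProb_ne_top (p := p) (σ := σ) ℓ' (h ++ [ℓ])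
    have h2 := hd.winProb_ne_top (p := p) (σ := σ) ℓ' (h ++ [ℓ.other])
    rw [winProb_eq] at h1 h2
    rw [winProb_eq, winProb_eq, winProb_eq, expectedTotal_eq h ℓ, if_neg (by simp [hh.2]), zero_add,
      ENNReal.toReal_add (ENNReal.mul_ne_top ENNReal.ofReal_ne_top h1)
        (ENNReal.mul_ne_top ENNReal.ofReal_ne_top h2),
      ENNReal.toReal_mul, ENNReal.toReal_mul, ENNReal.toReal_ofReal (hp.apply_nonneg _ _),
      ENNReal.toReal_ofReal (hp.apply_nonneg _ _)]
  have he : (M.expectedEffort p σ ℓ h).toReal = σ ℓ h +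
      (p (σ ℓ h) (σ ℓ.other h) * (M.expectedEffort p σ ℓ (h ++ [ℓ])).toReal +
      p (σ ℓ.other h) (σ ℓ h) * (M.expectedEffort p σ ℓ (h ++ [ℓ.other])).toReal) := by
    have h1 := hd.expectedEffort_ne_top (p := p) (σ := σ) ℓ (h ++ [ℓ])
    have h2 := hd.expectedEffort_ne_top (p := p) (σ := σ) ℓ (h ++ [ℓ.other])
    rw [expectedEffort_eq] at h1 h2
    have h3 := ENNReal.mul_ne_top (ENNReal.ofReal_ne_top (r := p (σ ℓ h) (σ ℓ.other h))) h1
    have h4 := ENNReal.mul_ne_top (ENNReal.ofReal_ne_top (r := p (σ ℓ.other h) (σ ℓ h))) h2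
    rw [expectedEffort_eq, expectedEffort_eq, expectedEffort_eq, expectedTotal_eq h ℓ, if_pos hh,
      ENNReal.toReal_add ENNReal.coe_ne_top (ENNReal.add_ne_top.2 ⟨h3, h4⟩),
      ENNReal.toReal_add h3 h4, ENNReal.coe_toReal,
      ENNReal.toReal_mul, ENNReal.toReal_mul, ENNReal.toReal_ofReal (hp.apply_nonneg _ _),
      ENNReal.toReal_ofReal (hp.apply_nonneg _ _)]
  have hadd := hp.add_eq_one (σ ℓ h) (σ ℓ.other h)
  have hq : p (σ ℓ.other h) (σ ℓ h) = 1 - p (σ ℓ h) (σ ℓ.other h) := by linarith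
  simp only [realPayoff, hw, he, hq]
  ring

/-- `u` assigns to each player and each history a payoff that is consistent with backward
induction: the prize at the end, and equilibrium payoffs of the current battle before. -/
structure IsValue (M : Contest) (p : ℝ≥0 → ℝ≥0 → ℝ) (v : ℝ) (u : Player → List Player → ℝ) :
    Prop where
  terminal : ∀ h ℓ, M.outcome h = some ℓ → u ℓ h = v ∧ u ℓ.other h = 0
  live : ∀ h, M.IsLive h →
    IsBattleValue p (fun ℓ => u ℓ (h ++ [ℓ])) (fun ℓ => u ℓ (h ++ [ℓ.other])) (fun ℓ => u ℓ h)

/-- The deviations that change the effort at a single history show that continuation payoffs are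
consistent with backward induction. -/
lemma IsEquilibrium.isValue (hp : IsHomogeneousSuccess p γ) (hd : M.HasDepth d)
    (hσ : M.IsEquilibrium p v σ) : M.IsValue p v (M.realPayoff p v σ) := by
  refine ⟨fun h ℓ hh => realPayoff_of_outcome hh, fun h hh => ⟨fun ℓ => σ ℓ h, fun ℓ =>
    ⟨hd.realPayoff_of_isLive hp hh ℓ, fun y => ?_⟩⟩⟩
  have h1 := hσ h hh ℓ (Function.update (σ ℓ) h y)
  rw [hd.payoff_eq, hd.payoff_eq, EReal.coe_le_coe_iff, hd.realPayoff_of_isLive hp hh] at h1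
  have h2 : ∀ ℓ₁ ℓ₂, M.realPayoff p v (Function.update σ ℓ (Function.update (σ ℓ) h y)) ℓ₁
      (h ++ [ℓ₂]) = M.realPayoff p v σ ℓ₁ (h ++ [ℓ₂]) := fun ℓ₁ ℓ₂ => by
    refine realPayoff_congr (fun ℓ' w => ?_) ℓ₁
    rcases eq_or_ne ℓ' ℓ with rfl | hne
    · rw [Function.update_self, Function.update_of_ne (by simp)]
    · rw [Function.update_of_ne hne]
  simpa only [h2, Function.update_self, Function.update_of_ne ℓ.other_ne] using h1

/-- Equilibrium payoffs of a contest of bounded length depend only on the subgame. -/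
lemma IsValue.eq_of_subgame_eq (hp : IsHomogeneousSuccess p γ) (hd : M.HasDepth d)
    (hu : M.IsValue p v u) (hu' : M'.IsValue p v u') {h' : List Player} (hh : M.IsHistory h)
    (hh' : M'.IsHistory h') (heq : ∀ w, M.outcome (h ++ w) = M'.outcome (h' ++ w)) (ℓ : Player) :
    u ℓ h = u' ℓ h' := by
  have h0 := heq []
  rw [List.append_nil, List.append_nil] at h0
  induction hn : d - h.length generalizing h h' ℓ with
  | zero =>
    cases ho : M.outcome h with
    | none => exact absurd (hd h ⟨hh, ho⟩) (by omega)
    | some ℓ₁ =>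
      have h1 := hu.terminal h ℓ₁ ho
      have h2 := hu'.terminal h' ℓ₁ (h0 ▸ ho)
      rcases ℓ₁.eq_or_eq_other ℓ with rfl | rfl
      · rw [h1.1, h2.1]
      · rw [h1.2, h2.2]
  | succ n ih =>
    cases ho : M.outcome h with
    | none =>
      have hl : M.IsLive h := ⟨hh, ho⟩
      have hl' : M'.IsLive h' := ⟨hh', h0 ▸ ho⟩
      have key : ∀ ℓ ℓ', u ℓ (h ++ [ℓ']) = u' ℓ (h' ++ [ℓ']) := fun ℓ ℓ' =>
        ih (hl.isHistory_append ℓ') (hl'.isHistory_append ℓ')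
          (fun w => by simpa using heq (ℓ' :: w)) ℓ (heq [ℓ'])
          (by rw [List.length_append, List.length_singleton]; omega)
      have h1 := hu.live h hl
      simp only [key] at h1
      exact congrFun (h1.unique hp (hu'.live h' hl')) ℓ
    | some ℓ₁ =>
      have h1 := hu.terminal h ℓ₁ ho
      have h2 := hu'.terminal h' ℓ₁ (h0 ▸ ho)
      rcases ℓ₁.eq_or_eq_other ℓ with rfl | rfl
      · rw [h1.1, h2.1]
      · rw [h1.2, h2.2]

lemma map_other_map_other (h : List Player) :
    (h.map Player.other).map Player.other = h := by simp [Function.comp_def]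

lemma IsSymmetric.isHistory_map (hM : M.IsSymmetric) (hh : M.IsHistory h) :
    M.IsHistory (h.map Player.other) := by
  intro g hg hne
  have h1 := hh (g.map Player.other)
    (by simpa only [map_other_map_other] using hg.map Player.other)
    fun h' => hne (by rw [← h', map_other_map_other])
  rw [hM] at h1
  simpa using h1

lemma IsValue.swap (hM : M.IsSymmetric) (hu : M.IsValue p v u) :
    M.IsValue p v fun ℓ h => u ℓ.other (h.map Player.other) := by
  refine ⟨fun h ℓ hh => hu.terminal _ ℓ.other (by rw [hM, hh]; rfl), fun h hh => ?_⟩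
  obtain ⟨x, hx⟩ := hu.live (h.map Player.other) ⟨hM.isHistory_map hh.1, by rw [hM, hh.2]; rfl⟩
  exact ⟨fun ℓ => x ℓ.other, fun ℓ => by simpa using hx ℓ.other⟩

lemma IsValue.apply_map_other (hp : IsHomogeneousSuccess p γ) (hd : M.HasDepth d)
    (hM : M.IsSymmetric) (hu : M.IsValue p v u) (hh : M.IsHistory h) (ℓ : Player) :
    u ℓ.other (h.map Player.other) = u ℓ h :=
  (hu.swap hM).eq_of_subgame_eq hp hd hu hh hh (fun _ => rfl) ℓ

lemma HasDepth.totalEffort_eq (hd : M.HasDepth d) :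
    M.totalEffort p σ =
      ENNReal.ofReal (v - (M.realPayoff p v σ .A [] + M.realPayoff p v σ .B [])) := by
  have hA := hd.expectedEffort_ne_top (p := p) (σ := σ) .A []
  have hB := hd.expectedEffort_ne_top (p := p) (σ := σ) .B []
  have : v - (M.realPayoff p v σ .A [] + M.realPayoff p v σ .B []) =
      (M.totalEffort p σ).toReal := by
    rw [totalEffort, ENNReal.toReal_add hA hB]
    simp only [realPayoff, Player.other]
    ring
  rw [this]
  exact (ENNReal.ofReal_toReal (ENNReal.add_ne_top.2 ⟨hA, hB⟩)).symm

/-! ### Streaks in extensions -/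

lemma isLive_replicate {N : ℕ} {ℓ : Player} (hN : M.outcome (List.replicate N ℓ) = some ℓ) {i : ℕ}
    (hi : i < N) : M.IsLive (List.replicate i ℓ) := by
  have key : ∀ j, j < N → M.outcome (List.replicate j ℓ) = none := fun j hj => by
    by_contra hne
    have h1 := M.no_redundancy _ (List.replicate (N - j) ℓ) hne (by simp; omega)
    rw [← List.replicate_add, Nat.add_sub_cancel' hj.le, hN] at h1
    exact Option.some_ne_none _ h1
  refine ⟨fun g hg _ => ?_, key i hi⟩
  obtain ⟨h1, h2⟩ := List.prefix_replicate_iff.1 hg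
  rw [h2]
  exact key _ (by omega)

namespace IsExtension

variable {N N' : ℕ}

lemma isHistory_cons_cons (hE : M'.IsExtension N' M) (ℓ : Player) (hh : M.IsHistory h) :
    M'.IsHistory (ℓ :: ℓ.other :: h) := by
  intro g hg hne
  rcases List.prefix_cons_iff.1 hg with rfl | ⟨g₁, rfl, hg₁⟩
  · exact M'.outcome_nil
  rcases List.prefix_cons_iff.1 hg₁ with rfl | ⟨g₂, rfl, hg₂⟩
  · exact (isLive_replicate (hE.streak ℓ) hE.two_le).2
  · rw [hE.subgame]
    exact hh g₂ hg₂ fun h' => hne (by rw [h'])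

lemma isHistory_loss (hE : M'.IsExtension N' M) {ℓ : Player} {i : ℕ} (hi : i + 1 < N') :
    M'.IsHistory (List.replicate (i + 1) ℓ ++ [ℓ.other]) :=
  (isLive_replicate (hE.streak ℓ) hi).isHistory_append _

/-- By exchangeability the loss may be moved to the second battle. -/
lemma outcome_loss (hE : M'.IsExtension N' M) {ℓ : Player}
    (hN : M.outcome (List.replicate N ℓ) = some ℓ) {i : ℕ} (hi : i + 1 < N') (hiN : i < N)
    (w : List Player) :
    M'.outcome (List.replicate (i + 1) ℓ ++ [ℓ.other] ++ w)
      = M.outcome (List.replicate i ℓ ++ w) := by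
  rw [hE.exchangeable _ (ℓ :: ℓ.other :: List.replicate i ℓ) (hE.isHistory_loss hi)
    (hE.isHistory_cons_cons ℓ (isLive_replicate hN hiN).1) _ w]
  · rw [List.cons_append, List.cons_append, hE.subgame]
  · rw [List.replicate_succ, List.cons_append]
    exact (List.perm_append_singleton _ _).cons ℓ

/-- An extension of a contest of bounded length has bounded length, as it reaches the original one
after at most one loss. -/
lemma exists_hasDepth (hE : M'.IsExtension N' M)
    (hN : ∀ ℓ, M.outcome (List.replicate N ℓ) = some ℓ)
    (hloss : ∀ (i : ℕ) (ℓ : Player), N < i → i < N' →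
      M'.outcome (List.replicate i ℓ ++ [ℓ.other]) = some ℓ)
    (hd : M.HasDepth d) : M'.HasDepth (max N' (d + 2)) := by
  intro h hh
  rcases h with _ | ⟨ℓ, h⟩
  · simp
  have key : ∀ (w : List Player) (i : ℕ), M'.IsLive (List.replicate (i + 1) ℓ ++ w) →
      i + 1 + w.length < max N' (d + 2) := by
    intro w
    induction w with
    | nil =>
      intro i hi
      rw [List.append_nil] at hi
      rw [List.length_nil, add_zero]
      refine lt_max_of_lt_left (lt_of_not_ge fun hle => ?_)
      have := not_isLive_append (M := M') (h := List.replicate N' ℓ)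
        (w := List.replicate (i + 1 - N') ℓ) (by simp [hE.streak])
      rw [← List.replicate_add, Nat.add_sub_cancel' hle] at this
      exact this hi
    | cons ℓ' w ih =>
      intro i hi
      rcases ℓ.eq_or_eq_other ℓ' with rfl | rfl
      · have := ih (i + 1) (by rwa [List.replicate_succ', List.append_assoc, List.singleton_append])
        rw [List.length_cons]
        omega
      · have hiN' : i + 1 < N' := by
          by_contra hle
          have := not_isLive_append (M := M') (h := List.replicate N' ℓ)
            (w := List.replicate (i + 1 - N') ℓ ++ ℓ.other :: w) (by simp [hE.streak])
          rw [← List.append_assoc, ← List.replicate_add, Nat.add_sub_cancel' (by omega)] at this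
          exact this hi
        rw [← List.singleton_append, ← List.append_assoc] at hi
        rcases lt_trichotomy i N with hiN | rfl | hiN
        · have hlive : M.IsLive (List.replicate i ℓ ++ w) := by
            refine ⟨fun g hg hne => ?_, by rw [← hE.outcome_loss (hN ℓ) hiN' hiN]; exact hi.2⟩
            have hrep := isLive_replicate (hN ℓ) hiN
            rcases List.prefix_or_prefix_of_prefix hg (List.prefix_append _ w)
              with hg' | ⟨w', rfl⟩
            · by_cases hgi : g = List.replicate i ℓ
              · rw [hgi, hrep.2]
              · exact hrep.1 g hg' hgi
            · rw [← hE.outcome_loss (hN ℓ) hiN' hiN]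
              exact hi.1 _
                ((List.prefix_append_right_inj _).2 ((List.prefix_append_right_inj _).1 hg))
                fun h' => hne (by rw [List.append_cancel_left h'])
          have := hd _ hlive
          rw [List.length_append, List.length_replicate] at this
          rw [List.length_cons]
          omega
        · exact absurd hi (not_isLive_append (by simp [hloss (i + 1) ℓ (Nat.lt_succ_self i) hiN']))
        · exact absurd hi (not_isLive_append (by simp [hloss (i + 1) ℓ (by omega) hiN']))
  have := key h 0 (by simpa using hh)
  rw [List.length_cons]
  omega

end IsExtension

end Contest

/-! ### The sequence of contests -/

namespace Contest

variable {M : ℕ → Contest} {p : ℝ≥0 → ℝ≥0 → ℝ} {γ : ℝ≥0∞ → ℝ} {v : ℝ} {N : ℕ → ℕ}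
  {u : ℕ → Player → List Player → ℝ}

/-- The payoff of player `ℓ` in the situation in which player `A` has won the first `i` battles; it
is that of a won or lost contest once the streak has length `N`. -/
noncomputable def streakPayoff (v : ℝ) (N : ℕ) (u : Player → List Player → ℝ) (ℓ : Player)
    (i : ℕ) : ℝ :=
  if i < N then u ℓ (List.replicate i .A) else if ℓ = .A then v else 0

lemma streakPayoff_of_le {M : Contest} {N : ℕ} {u : Player → List Player → ℝ}
    (hu : M.IsValue p v u) (hN : M.outcome (List.replicate N .A) = some .A) {i : ℕ} (hi : i ≤ N)
    (ℓ : Player) : streakPayoff v N u ℓ i = u ℓ (List.replicate i .A) := by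
  rw [streakPayoff]
  split_ifs with h1 h2
  · rfl
  · obtain rfl : i = N := by omega
    rw [h2, (hu.terminal _ _ hN).1]
  · obtain rfl : i = N := by omega
    obtain rfl : ℓ = Player.A.other := (Player.A.eq_or_eq_other ℓ).resolve_left h2
    rw [(hu.terminal _ _ hN).2]

lemma outcome_replicate (hM0 : (M 0).IsSingleBattle) (hN0 : N 0 = 1)
    (hE : ∀ k, (M (k + 1)).IsExtension (N (k + 1)) (M k)) (k : ℕ) (ℓ : Player) :
    (M k).outcome (List.replicate (N k) ℓ) = some ℓ := by
  cases k with
  | zero => simpa [hN0] using hM0 ℓ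
  | succ k => exact (hE k).streak ℓ

lemma IsSingleBattle.hasDepth {M : Contest} (hM : M.IsSingleBattle) : M.HasDepth 1 := by
  rintro (_ | ⟨ℓ, h⟩) hh
  · simp
  · exact absurd hh (not_isLive_append (h := [ℓ]) (by simp [hM ℓ]))

lemma exists_hasDepth (hM0 : (M 0).IsSingleBattle) (hN0 : N 0 = 1)
    (hE : ∀ k, (M (k + 1)).IsExtension (N (k + 1)) (M k))
    (hloss : ∀ (k i : ℕ) (ℓ : Player), N k < i → i < N (k + 1) →
      (M (k + 1)).outcome (List.replicate i ℓ ++ [ℓ.other]) = some ℓ) (k : ℕ) :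
    ∃ d, (M k).HasDepth d := by
  induction k with
  | zero => exact ⟨1, hM0.hasDepth⟩
  | succ k ih =>
    obtain ⟨d, hd⟩ := ih
    exact ⟨_, (hE k).exists_hasDepth (outcome_replicate hM0 hN0 hE k) (hloss k) hd⟩

lemma isStreakValue (hp : IsHomogeneousSuccess p γ) (hM0 : (M 0).IsSingleBattle) (hN0 : N 0 = 1)
    (hE : ∀ k, (M (k + 1)).IsExtension (N (k + 1)) (M k))
    (hloss : ∀ (k i : ℕ) (ℓ : Player), N k < i → i < N (k + 1) →
      (M (k + 1)).outcome (List.replicate i ℓ ++ [ℓ.other]) = some ℓ)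
    (hu : ∀ k, (M k).IsValue p v (u k)) :
    IsStreakValue p v N (fun k => streakPayoff v (N k) (u k) .A)
      (fun k => streakPayoff v (N k) (u k) .B) := by
  have hrep := outcome_replicate hM0 hN0 hE
  have hpos : ∀ k, 1 ≤ N k := by
    rintro (_ | k)
    · exact hN0.ge
    · exact one_le_two.trans (hE k).two_le
  have hsp : ∀ k i, i ≤ N k → ∀ ℓ,
      streakPayoff v (N k) (u k) ℓ i = u k ℓ (List.replicate i .A) := fun k i hi =>
    streakPayoff_of_le (hu k) (hrep k .A) hi
  have hswap : ∀ k h, (M k).IsHistory h → ∀ ℓ,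
      u k ℓ.other (h.map Player.other) = u k ℓ h := fun k h hh => by
    obtain ⟨d, hd⟩ := exists_hasDepth hM0 hN0 hE hloss k
    exact (hu k).apply_map_other hp hd (hE k).symmetric_base hh
  refine ⟨hN0, fun k => (hE k).two_le, fun k i hi => by simp [streakPayoff, not_lt.2 hi],
    fun k i hi => by simp [streakPayoff, not_lt.2 hi], fun k => ?_, fun k => ?_, fun k i hi => ?_⟩
  · rw [hsp k 0 (Nat.zero_le _), hsp k 0 (Nat.zero_le _)]
    exact hswap k [] isHistory_nil .A
  · have h1 := (hu k).live [] isLive_nil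
    have h2 := fun ℓ => hswap k [ℓ] (isLive_nil.isHistory_append ℓ)
    rw [hsp k 0 (Nat.zero_le _), hsp k 1 (hpos k), hsp k 1 (hpos k)]
    convert h1 using 1 <;> funext ℓ <;> cases ℓ
    · rfl
    · exact (h2 .A .A).symm
    · exact (h2 .A .B).symm
    · rfl
    · rfl
    · exact (hswap k [] isHistory_nil .A).symm
  · have hlive := isLive_replicate (hrep (k + 1) .A) hi
    have h1 := (hu (k + 1)).live _ hlive
    -- the payoffs after a loss are those of the smaller contest
    have h2 : ∀ ℓ, u (k + 1) ℓ (List.replicate (i + 1) .A ++ [.B])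
        = streakPayoff v (N k) (u k) ℓ i := fun ℓ => by
      rcases lt_or_ge i (N k) with hik | hik
      · obtain ⟨d, hd⟩ := exists_hasDepth hM0 hN0 hE hloss (k + 1)
        rw [hsp k i hik.le]
        exact (hu (k + 1)).eq_of_subgame_eq hp hd (hu k) ((hE k).isHistory_loss hi)
          (isLive_replicate (hrep k .A) hik).1 ((hE k).outcome_loss (hrep k .A) hi hik) ℓ
      · have h3 := (hu (k + 1)).terminal _ _ (hloss k (i + 1) .A (by omega) hi)
        rw [streakPayoff, if_neg (not_lt.2 hik)]
        cases ℓ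
        · exact h3.1
        · exact h3.2
    have h3 : ∀ ℓ, u (k + 1) ℓ (List.replicate (i + 1) .A ++ [.A])
        = streakPayoff v (N (k + 1)) (u (k + 1)) ℓ (i + 2) := fun ℓ => by
      rw [← List.replicate_succ', hsp (k + 1) (i + 2) (by omega)]
    have h4 := hsp (k + 1) (i + 1) hi.le
    convert h1 using 1 <;> funext ℓ <;> cases ℓ
    · exact (h3 .A).symm
    · exact (h2 .B).symm
    · exact (h2 .A).symm
    · exact (h3 .B).symm
    · exact h4 .A
    · exact h4 .B

end Contest

theorem mainTheorem4 (p : ℝ≥0 → ℝ≥0 → ℝ) (γ : ℝ≥0∞ → ℝ) (hp : IsHomogeneousSuccess p γ) :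
    ∃ α : ℝ, 0 < α ∧
      ∀ (v : ℝ) (M : ℕ → Contest) (N : ℕ → ℕ) (σ : ℕ → Profile) (ℓ₀ : Player) (L : ℝ),
        0 < v →
        (M 0).IsSingleBattle → N 0 = 1 →
        (∀ k, (M (k + 1)).IsExtension (N (k + 1)) (M k)) →
        -- a streak longer than what wins `M k`, followed by one loss, still wins `M (k + 1)`
        (∀ (k i : ℕ) (ℓ : Player), N k < i → i < N (k + 1) →
          (M (k + 1)).outcome (List.replicate i ℓ ++ [ℓ.other]) = some ℓ) →
        (∀ k, (M k).IsEquilibrium p v (σ k)) →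
        Tendsto (fun k => (M k).payoff p v (σ k) ℓ₀ []) atTop (𝓝 (L : EReal)) →
        α * v ≤ L ∧
          ∃ E : ℝ≥0∞, Tendsto (fun k => (M k).totalEffort p (σ k)) atTop (𝓝 E) ∧
            E < ENNReal.ofReal ((1 - 2 * α) * v) := by
  obtain ⟨s, hs, hs'⟩ := hp.exists_forall_le_netShare
  have hα := hp.netShare_one_pos
  have hC : 2 < 1 / netShare γ 1 + 2 * s := by
    have : 2 < 1 / netShare γ 1 := by
      rw [lt_div_iff₀ hα]
      linarith [hp.netShare_one_lt_half]
    linarith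
  -- half of the bound on the payoffs, so that the bound on the total effort is strict
  refine ⟨1 / 5 / (1 / netShare γ 1 + 2 * s), by positivity, ?_⟩
  intro v M N σ ℓ₀ L hv hM0 hN0 hE hloss hσ hL
  have hdep := Contest.exists_hasDepth hM0 hN0 hE hloss
  have hu : ∀ k, (M k).IsValue p v ((M k).realPayoff p v (σ k)) := fun k => by
    obtain ⟨d, hd⟩ := hdep k
    exact (hσ k).isValue hp hd
  have hsv := Contest.isStreakValue hp hM0 hN0 hE hloss hu
  have hsym : ∀ k ℓ, (M k).realPayoff p v (σ k) ℓ [] = (M k).realPayoff p v (σ k) .A [] := by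
    intro k ℓ
    obtain ⟨d, hd⟩ := hdep k
    cases ℓ
    · rfl
    · exact (hu k).apply_map_other hp hd (hE k).symmetric_base Contest.isHistory_nil .A
  have hL' : Tendsto (fun k => (M k).realPayoff p v (σ k) .A []) atTop (𝓝 L) := by
    rw [← EReal.tendsto_coe]
    refine hL.congr fun k => ?_
    obtain ⟨d, hd⟩ := hdep k
    rw [hd.payoff_eq, hsym]
  have hbound := hsv.le_limit hp hv hs hs' (L := L) (hL'.congr fun k => by
    have : 0 < N k := by
      cases k with
      | zero => omega
      | succ k => exact two_pos.trans_le (hE k).two_le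
    simp [Contest.streakPayoff, this])
  have h1 : 2 * (1 / 5 / (1 / netShare γ 1 + 2 * s)) * v ≤ L := by
    have : 2 * (1 / 5 / (1 / netShare γ 1 + 2 * s)) * v
        = 2 / 5 * v / (1 / netShare γ 1 + 2 * s) := by ring
    rw [this, div_le_iff₀ (by linarith)]
    linarith
  have h2 : 0 < 1 / 5 / (1 / netShare γ 1 + 2 * s) * v := by positivity
  have h3 : 1 / 5 / (1 / netShare γ 1 + 2 * s) < 1 / 10 := by
    rw [div_lt_iff₀ (by linarith)]
    linarith
  refine ⟨by linarith, ENNReal.ofReal (v - (L + L)), ?_, ?_⟩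
  · refine (ENNReal.tendsto_ofReal (tendsto_const_nhds.sub (hL'.add hL'))).congr fun k => ?_
    obtain ⟨d, hd⟩ := hdep k
    rw [hd.totalEffort_eq (v := v), hsym k .B]
  · rw [ENNReal.ofReal_lt_ofReal_iff (mul_pos (by linarith) hv)]
    linarith
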